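/- Let $X$ be a complex manifold of (finite) dimension $n$, Hausdorff and countable at infinity, and let $D\subset X$ be an open subset. **Approach regions.** A system of approach regions $\mathcal A=(\mathcal A_\alpha(\zeta))_{\zeta\in\overline D,\ \alpha\in I_\zeta}$ for $D$ is a collection of open subsets of $D$ such that, for $\zeta\in D$, $(\mathcal A_\alpha(\zeta))_{\alpha\in I_\zeta}$ is a basis of open neighborhoods of $\zeta$, and, for $\zeta\in\partial D$, $I_\zeta\neq\varnothing$ and $\zeta\in\overline{\mathcal A_\alpha(\zeta)}$ for all $\alpha\in I_\zeta$. It is *canonical* if for every $\zeta\in\partial D$ there is a basis of open neighborhoods $(U_\alpha)_{\alpha\in I_\zeta}$ of $\zeta$ in $X$ with $\mathcal A_\alpha(\zeta)=U_\alpha\cap D$ for $\alpha\in I_\zeta$. For an open set $U\subset X$, the set $D\cap U$ carries the induced system, given by $\mathcal A_\alpha(\zeta)\cap U$ at the points $\zeta\in U\cap\overline{D}$ (and canonical regions at the other points of $\overline{D\cap U}$). **Extremal functions.** For $u:D\to[-\infty,\infty)$ and $z\in\overline D$ put $$(\mathcal A\text{-}\limsup u)(z)=\sup_{\alpha\in I_z}\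 \limsup_{w\in\mathcal A_\alpha(z),\,w\to z}u(w).$$ For $A\subset\overline D$ let $h_{A,D}$ be the pointwise supremum of all functions $u$ plurisubharmonic on $D$ with $u\le 1$ on $D$ and $\mathcal A\text{-}\limsup u\le 0$ on $A$, and let $\omega(z,A,D)=(\mathcal A\text{-}\limsup h_{A,D})(z)$ for $z\in\overline D$. **Local pluriregularity.** $A\subset\overline D$ is *locally pluriregular at* $a\in\overline A$ if $\omega(a,A\cap U,D\cap U)=0$ for all open neighborhoods $U$ of $a$ (with the induced system on $D\cap U$); $A$ is *locally pluriregular* if it is so at every $a\in A$. Put $$A^*=(A\cap\partial D)\cup\{a\in\overline A\cap D:\ A\text{ is locally pluriregular at }a\},$$ and let $\widetilde A$ be the union of all locally pluriregular sets $P\subset\overline D$ with $\overline P\subset A^*$. **Topological hypersurfaces.** A topological hypersurface in $\mathbb C^n$ is a graph $\{z=(z',x_n+iy_n)\in\mathbb C^n:\ (z',x_n)\in U,\ y_n=h(z',x_n)\}$, where $U\subset\mathbb C^{n-1}\times\mathbb R=\mathbb R^{2n-1}$ is open and $h:U\to\mathbb R$ is continuous. A subset $A\subset X$ is a topological hypersurface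 if for every $a\in A$ there is a holomorphic chart $(U,\phi)$ of $X$ around $a$ such that $\phi(A\cap U)$ is a topological hypersurface in $\mathbb C^n$. **Proposition.** Let $D$ be equipped with a canonical system of approach regions, and let $A\subset\partial D$ be a set that is open in $\partial D$ (for the topology induced by $X$) and that is a topological hypersurface. Then $A$ is locally pluriregular and $\widetilde A=A$. -/

import Mathlib

open Set Filter Topology MeasureTheory TopologicalSpace
open scoped Manifold ContDiff ENNReal

namespace SepHolo

noncomputable section

/-! ### Plurisubharmonic functions -/

/-- The mean of `u` over the circle `{z + e^{iθ} w}`, as an extended real number (integral of the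
positive part minus integral of the negative part, for the normalized arc length; the parameter is
`t = θ / 2π`). For `u` upper semicontinuous with values in `[-∞, ∞)` the first integral is finite,
so that the mean is a well-defined element of `[-∞, ∞)`. -/
def circleMean {n : ℕ} (u : (Fin n → ℂ) → EReal) (z w : Fin n → ℂ) : EReal :=
  ((∫⁻ t in Icc (0 : ℝ) 1,
      (u (z + Complex.exp (2 * Real.pi * Complex.I * t) • w)).toENNReal : ℝ≥0∞) : EReal) -
  ((∫⁻ t in Icc (0 : ℝ) 1,
      (-u (z + Complex.exp (2 * Real.pi * Complex.I * t) • w)).toENNReal : ℝ≥0∞) : EReal)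

/-- Plurisubharmonic functions on an open subset `Ω` of `ℂⁿ`: upper semicontinuous, with values in
`[-∞, ∞)`, and with the sub-mean value property on every closed complex disc contained in `Ω`
(the function that is identically `-∞` is allowed). Only the values on `Ω` matter. -/
structure IsPSHOnCn {n : ℕ} (u : (Fin n → ℂ) → EReal) (Ω : Set (Fin n → ℂ)) : Prop where
  lt_top : ∀ z ∈ Ω, u z < ⊤
  usc : UpperSemicontinuousOn u Ω
  le_mean : ∀ z w : Fin n → ℂ, (∀ c : ℂ, ‖c‖ ≤ 1 → z + c • w ∈ Ω) → u z ≤ circleMean u z w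

/-- `u` is plurisubharmonic on the open subset `D` of the complex manifold `X`: it is so in every
holomorphic chart. Only the values on `D` matter. -/
def IsPSHOn (n : ℕ) {X : Type*} [TopologicalSpace X] [ChartedSpace (Fin n → ℂ) X]
    (u : X → EReal) (D : Set X) : Prop :=
  ∀ e ∈ IsManifold.maximalAtlas 𝓘(ℂ, Fin n → ℂ) ω X,
    IsPSHOnCn (fun z => u (e.symm z)) (e.target ∩ e.symm ⁻¹' D)

/-! ### Systems of approach regions -/

/-- A system of approach regions for the open subset `D` of `X`. The family
`(𝒜_α(ζ))_{α ∈ I_ζ}` is represented by the set `regions ζ` of its members; only the points `ζ` of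
the closure of `D` matter. -/
structure ApproachSystem {X : Type*} [TopologicalSpace X] (D : Opens X) where
  regions : X → Set (Set X)
  isOpen_region : ∀ ζ ∈ closure (D : Set X), ∀ R ∈ regions ζ, IsOpen R
  region_subset : ∀ ζ ∈ closure (D : Set X), ∀ R ∈ regions ζ, R ⊆ (D : Set X)
  mem_region : ∀ ζ ∈ D, ∀ R ∈ regions ζ, ζ ∈ R
  exists_region_subset : ∀ ζ ∈ D, ∀ U : Set X, IsOpen U → ζ ∈ U → ∃ R ∈ regions ζ, R ⊆ U
  regions_nonempty : ∀ ζ ∈ frontier (D : Set X), (regions ζ).Nonempty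
  mem_closure_region : ∀ ζ ∈ frontier (D : Set X), ∀ R ∈ regions ζ, ζ ∈ closure R

namespace ApproachSystem

variable {X : Type*} [TopologicalSpace X] {D : Opens X}

/-- The system is canonical: at every boundary point `ζ` of `D` the approach regions are the sets
`U ∩ D`, where `U` runs through a basis of open neighborhoods of `ζ` in `X`. -/
def IsCanonical (𝒜 : ApproachSystem D) : Prop :=
  ∀ ζ ∈ frontier (D : Set X), ∃ B : Set (Set X),
    (∀ U ∈ B, IsOpen U ∧ ζ ∈ U) ∧
    (∀ V : Set X, IsOpen V → ζ ∈ V → ∃ U ∈ B, U ⊆ V) ∧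
    𝒜.regions ζ = (fun U => U ∩ (D : Set X)) '' B

/-- The system induced on `D ∩ U`, for an open set `U`: at the points `ζ ∈ U` the approach regions
are the sets `𝒜_α(ζ) ∩ U`, and at the other points they are the canonical ones. -/
def restrict (𝒜 : ApproachSystem D) (U : Opens X) : ApproachSystem (D ⊓ U) where
  regions ζ := {V | (ζ ∈ U ∧ ∃ R ∈ 𝒜.regions ζ, V = R ∩ (U : Set X)) ∨
    (ζ ∉ U ∧ ∃ O : Set X, IsOpen O ∧ ζ ∈ O ∧ V = O ∩ ((D : Set X) ∩ (U : Set X)))}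
  isOpen_region := by
    intro ζ hζ V hV
    have hζD : ζ ∈ closure (D : Set X) := closure_mono inter_subset_left hζ
    rcases hV with ⟨_, R, hR, rfl⟩ | ⟨_, O, hO, _, rfl⟩
    · exact (𝒜.isOpen_region ζ hζD R hR).inter U.isOpen
    · exact hO.inter (D.isOpen.inter U.isOpen)
  region_subset := by
    intro ζ hζ V hV
    have hζD : ζ ∈ closure (D : Set X) := closure_mono inter_subset_left hζ
    rcases hV with ⟨_, R, hR, rfl⟩ | ⟨_, O, _, _, rfl⟩
    · exact inter_subset_inter_left _ (𝒜.region_subset ζ hζD R hR)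
    · exact inter_subset_right
  mem_region := by
    intro ζ hζ V hV
    rcases hV with ⟨hU, R, hR, rfl⟩ | ⟨hU, _⟩
    · exact ⟨𝒜.mem_region ζ hζ.1 R hR, hU⟩
    · exact absurd hζ.2 hU
  exists_region_subset := by
    intro ζ hζ W hW hζW
    obtain ⟨R, hR, hRW⟩ := 𝒜.exists_region_subset ζ hζ.1 W hW hζW
    exact ⟨R ∩ (U : Set X), Or.inl ⟨hζ.2, R, hR, rfl⟩, inter_subset_left.trans hRW⟩
  regions_nonempty := by
    intro ζ hζ
    by_cases hU : ζ ∈ U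
    · have hζD : ζ ∈ closure (D : Set X) :=
        closure_mono inter_subset_left (frontier_subset_closure hζ)
      have hne : (𝒜.regions ζ).Nonempty := by
        by_cases hD : ζ ∈ D
        · obtain ⟨R, hR, _⟩ := 𝒜.exists_region_subset ζ hD univ isOpen_univ (mem_univ _)
          exact ⟨R, hR⟩
        · refine 𝒜.regions_nonempty ζ ?_
          rw [D.isOpen.frontier_eq]
          exact ⟨hζD, hD⟩
      obtain ⟨R, hR⟩ := hne
      exact ⟨R ∩ (U : Set X), Or.inl ⟨hU, R, hR, rfl⟩⟩
    · exact ⟨univ ∩ ((D : Set X) ∩ (U : Set X)),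
        Or.inr ⟨hU, univ, isOpen_univ, mem_univ _, rfl⟩⟩
  mem_closure_region := by
    intro ζ hζ V hV
    have hζc : ζ ∈ closure ((D : Set X) ∩ (U : Set X)) := frontier_subset_closure hζ
    have hζn : ζ ∉ (D : Set X) ∩ (U : Set X) := by
      have h := hζ
      rw [(D ⊓ U).isOpen.frontier_eq] at h
      exact h.2
    rcases hV with ⟨hU, R, hR, rfl⟩ | ⟨_, O, hO, hζO, rfl⟩
    · have hfr : ζ ∈ frontier (D : Set X) := by
        rw [D.isOpen.frontier_eq]
        exact ⟨closure_mono inter_subset_left hζc, fun hD => hζn ⟨hD, hU⟩⟩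
      have h := 𝒜.mem_closure_region ζ hfr R hR
      rw [mem_closure_iff] at h ⊢
      intro W hW hζW
      obtain ⟨x, ⟨hxW, hxU⟩, hxR⟩ := h (W ∩ (U : Set X)) (hW.inter U.isOpen) ⟨hζW, hU⟩
      exact ⟨x, hxW, hxR, hxU⟩
    · rw [mem_closure_iff] at hζc ⊢
      intro W hW hζW
      obtain ⟨x, ⟨hxW, hxO⟩, hx⟩ := hζc (W ∩ O) (hW.inter hO) ⟨hζW, hζO⟩
      exact ⟨x, hxW, hxO, hx⟩

/-- The function `𝒜-limsup u`, at the point `z` of the closure of `D`. -/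
def alimsup (𝒜 : ApproachSystem D) (u : X → EReal) (z : X) : EReal :=
  ⨆ R ∈ 𝒜.regions z, limsup u (𝓝[R] z)

/-- The function `h_{A,D}`: the supremum of the functions `u` plurisubharmonic on `D` with
`u ≤ 1` on `D` and `𝒜-limsup u ≤ 0` on `A`. It is meaningful on `D` only. -/
def extremalSup (n : ℕ) {X : Type*} [TopologicalSpace X] {D : Opens X}
    [ChartedSpace (Fin n → ℂ) X] (𝒜 : ApproachSystem D) (A : Set X) (z : X) : EReal :=
  ⨆ u ∈ {u : X → EReal | IsPSHOn n u (D : Set X) ∧ (∀ x ∈ D, u x ≤ 1) ∧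
    ∀ a ∈ A, 𝒜.alimsup u a ≤ 0}, u z

/-- The relative extremal function `ω(z, A, D)` of `A` relative to `D`, for `z` in the closure
of `D`. -/
def relExtremal (n : ℕ) {X : Type*} [TopologicalSpace X] {D : Opens X}
    [ChartedSpace (Fin n → ℂ) X] (𝒜 : ApproachSystem D) (A : Set X) (z : X) : EReal :=
  𝒜.alimsup (extremalSup n 𝒜 A) z

/-- `A` is locally pluriregular at `a`: the relative extremal function of `A ∩ U` relative to
`D ∩ U` vanishes at `a`, for every open neighborhood `U` of `a`. -/
def IsLocallyPluriregularAt (n : ℕ) {X : Type*} [TopologicalSpace X] {D : Opens X}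
    [ChartedSpace (Fin n → ℂ) X] (𝒜 : ApproachSystem D) (A : Set X) (a : X) : Prop :=
  ∀ U : Opens X, a ∈ U → relExtremal n (𝒜.restrict U) (A ∩ (U : Set X)) a = 0

/-- `A` is locally pluriregular: it is so at each of its points. -/
def IsLocallyPluriregular (n : ℕ) {X : Type*} [TopologicalSpace X] {D : Opens X}
    [ChartedSpace (Fin n → ℂ) X] (𝒜 : ApproachSystem D) (A : Set X) : Prop :=
  ∀ a ∈ A, IsLocallyPluriregularAt n 𝒜 A a

/-- The set `A^*`. -/
def starSet (n : ℕ) {X : Type*} [TopologicalSpace X] {D : Opens X}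
    [ChartedSpace (Fin n → ℂ) X] (𝒜 : ApproachSystem D) (A : Set X) : Set X :=
  (A ∩ frontier (D : Set X)) ∪
    {a | a ∈ closure A ∩ (D : Set X) ∧ IsLocallyPluriregularAt n 𝒜 A a}

/-- The set `Ã`: the union of all locally pluriregular subsets `P` of the closure of `D` whose
closure is contained in `A^*`. -/
def tildeSet (n : ℕ) {X : Type*} [TopologicalSpace X] {D : Opens X}
    [ChartedSpace (Fin n → ℂ) X] (𝒜 : ApproachSystem D) (A : Set X) : Set X :=
  ⋃₀ {P | P ⊆ closure (D : Set X) ∧ IsLocallyPluriregular n 𝒜 P ∧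
    closure P ⊆ starSet n 𝒜 A}

end ApproachSystem

/-! ### Topological hypersurfaces -/

/-- Topological hypersurfaces in `ℂⁿ`: graphs `{z | (z', x_n) ∈ U, y_n = h (z', x_n)}` of a
continuous real function `h` on an open subset `U` of `ℂⁿ⁻¹ × ℝ = ℝ²ⁿ⁻¹`, where `z = (z', z_n)` and
`z_n = x_n + i y_n`. Here `j` is the index of the last coordinate. -/
def IsTopologicalHypersurfaceCn {n : ℕ} (S : Set (Fin n → ℂ)) : Prop :=
  ∃ j : Fin n, j.val + 1 = n ∧
    ∃ (U : Set (({i : Fin n // i ≠ j} → ℂ) × ℝ)) (h : ({i : Fin n // i ≠ j} → ℂ) × ℝ → ℝ),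
      IsOpen U ∧ ContinuousOn h U ∧
      S = {z | ((fun i => z i.1, (z j).re) : ({i : Fin n // i ≠ j} → ℂ) × ℝ) ∈ U ∧
        (z j).im = h (fun i => z i.1, (z j).re)}

/-- Topological hypersurfaces in a complex manifold: around each point of `A` there is a holomorphic
chart that maps `A` onto a topological hypersurface in `ℂⁿ`. -/
def IsTopologicalHypersurface (n : ℕ) {X : Type*} [TopologicalSpace X]
    [ChartedSpace (Fin n → ℂ) X] (A : Set X) : Prop :=
  ∀ a ∈ A, ∃ e ∈ IsManifold.maximalAtlas 𝓘(ℂ, Fin n → ℂ) ω X,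
    a ∈ e.source ∧ IsTopologicalHypersurfaceCn (e '' (A ∩ e.source))

end

end SepHolo

/-!
The proof rests on a uniform barrier. In a chart around a point `a ∈ A`, the boundary of `D` is the
graph `y_n = h (z', x_n)`. Given `z` in `D` close to `a`, consider the complex line through `z`
in the direction of the last axis, and on it the part `G` of `D` that lies in a disc of fixed radius
`ρ`, on the same side of the graph as `z`, the center being the point `z₀` of the graph with the
same `x_n` as `z`. The set `G` does not meet the vertical half-line that leaves `z₀` away from
that side, so that a branch of the cubic root of `ζ - z₀` is holomorphic on `G`. Its real part is at
least `|ζ - z₀| ^ (1 / 3) / 2`, and the maximum principle bounds every admissible plurisubharmonic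
function `u` at the point `z` by `2 ρ ^ (-1 / 3) |z_n - z₀| ^ (1 / 3)` (`IsSubmeanOn.le_re`,
`IsSubmeanOn.le_rpow`). Since this bound is independent of `u` and tends to `0` as `z` tends to `a`
(`eventually_forall_psh_le`), the extremal function vanishes at `a`. No information on the
connected components of `D` near `a` is needed: `D` may lie on both sides of `A`.

For the second claim, `A^* = A` because the closure of `A` does not meet `D`
(`ApproachSystem.starSet_eq_self`); and each point of `A` lies in a piece of `A` that is open in the
boundary of `D`, hence locally pluriregular by the same argument, and whose closure is
contained in `A`.
-/

namespace SepHolo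

/-! ### Subharmonicity in the plane -/

/-- Comparison form of the sub-mean value property on `G ⊆ ℂ`: on every closed disc in `G`, a real
part of a function holomorphic on `G` that dominates `v` on the circle dominates `v` at the center.
This form involves no integrals of functions with values in `EReal`. -/
def IsSubmeanOn (v : ℂ → EReal) (G : Set ℂ) : Prop :=
  ∀ (p : ℂ) (r : ℝ) (F : ℂ → ℂ), 0 < r → Metric.closedBall p r ⊆ G → DifferentiableOn ℂ F G →
    (∀ ζ ∈ Metric.sphere p r, v ζ ≤ ((F ζ).re : EReal)) → v p ≤ ((F p).re : EReal)

theorem circleMap_eq_add_exp_mul (p : ℂ) (r t : ℝ) :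
    circleMap p r (2 * Real.pi * t) = p + Complex.exp (2 * Real.pi * Complex.I * t) * r := by
  rw [circleMap, mul_comm (r : ℂ)]
  congr 3
  push_cast
  ring

/-- The circle average over `[0, 2π]`, written with the normalized parameter in `[0, 1]`. -/
theorem integral_Icc_circleMap (g : ℂ → ℝ) (p : ℂ) (r : ℝ) :
    ∫ t in Icc (0 : ℝ) 1, g (circleMap p r (2 * Real.pi * t)) = Real.circleAverage g p r := by
  rw [integral_Icc_eq_integral_Ioc, ← intervalIntegral.integral_of_le zero_le_one,
    intervalIntegral.integral_comp_mul_left (fun θ => g (circleMap p r θ))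
      (by positivity : (2 * Real.pi) ≠ 0), Real.circleAverage_def]
  simp

/-- The difference of integrals that defines `circleMean`, for a function with an integrable real
majorant; no measurability of the function is needed. -/
theorem coe_toENNReal_sub_le_integral {k : ℝ → EReal} {g : ℝ → ℝ} {s : Set ℝ}
    (hg : IntegrableOn g s) (hkg : ∀ t, k t ≤ (g t : EReal)) :
    ((∫⁻ t in s, (k t).toENNReal : ℝ≥0∞) : EReal) - ((∫⁻ t in s, (-k t).toENNReal : ℝ≥0∞) : EReal)
      ≤ ((∫ t in s, g t : ℝ) : EReal) := by
  have hpos : (∫⁻ t in s, ENNReal.ofReal (g t)) ≠ ⊤ := by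
    refine ne_of_lt (lt_of_le_of_lt (lintegral_mono fun t => ?_) hg.2)
    exact Real.ofReal_le_enorm (g t)
  have hneg : (∫⁻ t in s, ENNReal.ofReal (-g t)) ≠ ⊤ := by
    refine ne_of_lt (lt_of_le_of_lt (lintegral_mono fun t => ?_) hg.2)
    rw [← enorm_neg]
    exact Real.ofReal_le_enorm (-g t)
  have key : ((∫ t in s, g t : ℝ) : EReal) = ((∫⁻ t in s, ENNReal.ofReal (g t) : ℝ≥0∞) : EReal) -
      ((∫⁻ t in s, ENNReal.ofReal (-g t) : ℝ≥0∞) : EReal) := by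
    rw [integral_eq_lintegral_pos_part_sub_lintegral_neg_part hg, EReal.coe_sub,
      EReal.coe_ennreal_toReal hpos, EReal.coe_ennreal_toReal hneg]
  rw [key]
  refine EReal.sub_le_sub ?_ ?_
  · refine EReal.coe_ennreal_le_coe_ennreal_iff.2 (lintegral_mono fun t => ?_)
    rw [← EReal.real_coe_toENNReal]
    exact EReal.toENNReal_le_toENNReal (hkg t)
  · refine EReal.coe_ennreal_le_coe_ennreal_iff.2 (lintegral_mono fun t => ?_)
    rw [← EReal.real_coe_toENNReal, EReal.coe_neg]
    exact EReal.toENNReal_le_toENNReal (EReal.neg_le_neg_iff.2 (hkg t))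

theorem update_add_smul {n : ℕ} (z : Fin n → ℂ) (j : Fin n) (p r c : ℂ) :
    Function.update z j p + c • Pi.single j r = Function.update z j (p + c * r) := by
  ext i
  by_cases h : i = j
  · subst h; simp
  · simp [h]

/-- Restrictions of plurisubharmonic functions to lines parallel to a coordinate axis. -/
theorem IsPSHOnCn.isSubmeanOn_update {n : ℕ} {u : (Fin n → ℂ) → EReal} {Ω : Set (Fin n → ℂ)}
    (hu : IsPSHOnCn u Ω) (z : Fin n → ℂ) (j : Fin n) {G : Set ℂ}
    (hGΩ : ∀ ζ ∈ G, Function.update z j ζ ∈ Ω) :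
    IsSubmeanOn (fun ζ => u (Function.update z j ζ)) G := by
  intro p r F hr hp hFG hle
  have hF : DifferentiableOn ℂ F (Metric.closedBall p r) := hFG.mono hp
  have hmean := hu.le_mean (Function.update z j p) (Pi.single j (r : ℂ)) (by
    intro c hc
    rw [update_add_smul]
    refine hGΩ _ (hp ?_)
    rw [Metric.mem_closedBall, dist_eq_norm, add_sub_cancel_left, norm_mul, Complex.norm_real,
      Real.norm_of_nonneg hr.le]
    exact mul_le_of_le_one_left hr.le hc)
  refine hmean.trans ?_
  have hmem : ∀ t : ℝ, circleMap p r (2 * Real.pi * t) ∈ Metric.sphere p r := fun t =>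
    circleMap_mem_sphere p hr.le _
  have hcont : Continuous fun t : ℝ => F (circleMap p r (2 * Real.pi * t)) :=
    hF.continuousOn.comp_continuous ((continuous_circleMap p r).comp (continuous_const_mul _))
      fun t => Metric.sphere_subset_closedBall (hmem t)
  have hre : Continuous fun t : ℝ => (F (circleMap p r (2 * Real.pi * t))).re :=
    Complex.continuous_re.comp hcont
  have hval : ∫ t in Icc (0 : ℝ) 1, (F (circleMap p r (2 * Real.pi * t))).re = (F p).re := by
    have hball : DiffContOnCl ℂ F (Metric.ball p |r|) := by
      rw [abs_of_pos hr]
      refine DifferentiableOn.diffContOnCl ?_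
      rwa [closure_ball p hr.ne']
    rw [← hball.circleAverage, Real.circleAverage_def]
    have := integral_Icc_circleMap (fun ζ => (F ζ).re) p r
    rw [this, Real.circleAverage_def]
    have hint : IntervalIntegrable (fun θ => F (circleMap p r θ)) volume 0 (2 * Real.pi) :=
      (hF.continuousOn.comp_continuous (continuous_circleMap p r) fun t =>
        Metric.sphere_subset_closedBall (circleMap_mem_sphere p hr.le _)).intervalIntegrable _ _
    have h2 := Complex.reCLM.intervalIntegral_comp_comm hint
    simp only [Complex.reCLM_apply] at h2
    rw [h2]
    simp
  rw [← hval]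
  refine coe_toENNReal_sub_le_integral (hre.continuousOn.integrableOn_compact isCompact_Icc)
    fun t => ?_
  rw [update_add_smul, ← circleMap_eq_add_exp_mul]
  exact hle _ (hmem t)

/-! ### Maximum principle -/

/-- Maximum principle on a bounded plane domain: boundary estimates by the real part of a
holomorphic function propagate to the interior. -/
theorem IsSubmeanOn.le_re {v : ℂ → EReal} {G : Set ℂ} (hsub : IsSubmeanOn v G) (hG : IsOpen G)
    (hbdd : Bornology.IsBounded G) (husc : UpperSemicontinuousOn v G) (hlt : ∀ ζ ∈ G, v ζ < ⊤)
    {F : ℂ → ℂ} (hF : DifferentiableOn ℂ F G)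
    (hbd : ∀ q ∈ frontier G, ∀ η : ℝ, 0 < η → ∀ᶠ ζ in 𝓝[G] q, v ζ ≤ (((F ζ).re + η : ℝ) : EReal))
    {ζ₀ : ℂ} (hζ₀ : ζ₀ ∈ G) : v ζ₀ ≤ ((F ζ₀).re : EReal) := by
  classical
  by_contra! hcon
  obtain ⟨y, hy₁, hy₂⟩ := EReal.lt_iff_exists_real_btwn.1 hcon
  obtain ⟨m, hm⟩ : ∃ m, m = y - (F ζ₀).re := ⟨_, rfl⟩
  have hm0 : 0 < m := by rw [hm]; exact sub_pos.2 (EReal.coe_lt_coe_iff.1 hy₁)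
  obtain ⟨R, hR0, hR⟩ := hbdd.subset_closedBall_lt 0 0
  -- The perturbation `ε ‖ζ‖ ^ 2` makes the difference strictly subharmonic.
  obtain ⟨ε, hε⟩ : ∃ ε, ε = m / (2 * R ^ 2) := ⟨_, rfl⟩
  have hε0 : 0 < ε := by rw [hε]; positivity
  have hεR : ∀ ζ ∈ G, ε * ‖ζ‖ ^ 2 ≤ m / 2 := by
    intro ζ hζ
    have h1 : ‖ζ‖ ≤ R := by simpa using hR hζ
    calc ε * ‖ζ‖ ^ 2 ≤ ε * R ^ 2 := by gcongr
      _ = m / 2 := by rw [hε]; field_simp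
  obtain ⟨g, hg⟩ : ∃ g : ℂ → ℝ, g = fun ζ => ε * ‖ζ‖ ^ 2 - (F ζ).re := ⟨_, rfl⟩
  have hgc : ContinuousOn g G := by
    rw [hg]
    exact (by fun_prop : Continuous fun ζ : ℂ => ε * ‖ζ‖ ^ 2).continuousOn.sub
      (Complex.continuous_re.comp_continuousOn hF.continuousOn)
  -- With the value `m` off `G`, the function below is upper semicontinuous up to the boundary.
  obtain ⟨V, hV⟩ : ∃ V : ℂ → EReal,
      V = fun ζ => if ζ ∈ G then v ζ + (g ζ : EReal) else (m : EReal) := ⟨_, rfl⟩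
  have hVG : ∀ ζ ∈ G, V ζ = v ζ + (g ζ : EReal) := fun ζ hζ => by rw [hV]; simp [hζ]
  have hVn : ∀ ζ ∉ G, V ζ = m := fun ζ hζ => by rw [hV]; simp [hζ]
  have hVusc : UpperSemicontinuousOn V (closure G) := by
    intro q hq
    by_cases hqG : q ∈ G
    · have h1 : UpperSemicontinuousWithinAt (fun ζ => v ζ + (g ζ : EReal)) G q := by
        refine UpperSemicontinuousWithinAt.add' (husc q hqG) ?_ ?_
        · exact ContinuousWithinAt.upperSemicontinuousWithinAt
            (continuous_coe_real_ereal.continuousAt.comp_continuousWithinAt (hgc q hqG))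
        · exact EReal.continuousAt_add (Or.inl (hlt q hqG).ne) (Or.inr (EReal.coe_ne_top _))
      intro y hy
      have h2 := h1 y (show v q + (g q : EReal) < y from hVG q hqG ▸ hy)
      rw [hG.nhdsWithin_eq hqG] at h2
      filter_upwards [mem_nhdsWithin_of_mem_nhds h2, mem_nhdsWithin_of_mem_nhds (hG.mem_nhds hqG)]
        with ζ hζ hζG
      rwa [hVG ζ hζG]
    · intro y hy
      rw [hVn q hqG] at hy
      have hqf : q ∈ frontier G := by rw [hG.frontier_eq]; exact ⟨hq, hqG⟩
      have h1 := hbd q hqf (m / 2) (by positivity)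
      rw [eventually_nhdsWithin_iff] at h1
      filter_upwards [mem_nhdsWithin_of_mem_nhds h1] with ζ hζ
      refine lt_of_le_of_lt ?_ hy
      by_cases hζG : ζ ∈ G
      · rw [hVG ζ hζG]
        refine (add_le_add_left (hζ hζG) _).trans ?_
        rw [← EReal.coe_add, EReal.coe_le_coe_iff, hg]
        have := hεR ζ hζG
        simp only
        linarith
      · rw [hVn ζ hζG]
  obtain ⟨p, hpc, hpmax⟩ := hVusc.exists_isMaxOn ⟨ζ₀, subset_closure hζ₀⟩ hbdd.isCompact_closure
  have hVp : (m : EReal) < V p := by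
    refine lt_of_lt_of_le ?_ (hpmax (subset_closure hζ₀))
    rw [hVG ζ₀ hζ₀]
    have h1 : (m : EReal) ≤ (y : EReal) + (g ζ₀ : EReal) := by
      rw [← EReal.coe_add, EReal.coe_le_coe_iff, hm, hg]
      have : 0 ≤ ε * ‖ζ₀‖ ^ 2 := by positivity
      simp only
      linarith
    exact h1.trans_lt (EReal.add_lt_add_right_coe hy₂ _)
  have hpG : p ∈ G := by
    by_contra h
    exact (hVn p h ▸ hVp).false
  rw [hVG p hpG] at hVp
  obtain ⟨x, hx⟩ : ∃ x : ℝ, v p = x := by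
    induction hvp : v p with
    | bot => rw [hvp, EReal.bot_add] at hVp; exact absurd hVp not_lt_bot
    | top => exact absurd hvp (hlt p hpG).ne
    | coe x => exact ⟨x, rfl⟩
  have hle : ∀ ζ ∈ G, v ζ ≤ ((x + g p - g ζ : ℝ) : EReal) := by
    intro ζ hζ
    have h1 : V ζ ≤ V p := hpmax (subset_closure hζ)
    rw [hVG ζ hζ, hVG p hpG, hx] at h1
    induction hvζ : v ζ with
    | bot => exact bot_le
    | top => exact absurd hvζ (hlt ζ hζ).ne
    | coe w =>
      rw [hvζ, ← EReal.coe_add, ← EReal.coe_add, EReal.coe_le_coe_iff] at h1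
      rw [EReal.coe_le_coe_iff]
      linarith
  obtain ⟨r, hr0, hr⟩ := Metric.nhds_basis_closedBall.mem_iff.1 (hG.mem_nhds hpG)
  -- On the circle of center `p` and radius `r`, `‖ζ‖ ^ 2` is the real part of the affine function
  -- `r ^ 2 + ‖p‖ ^ 2 + 2 (ζ - p) * conj p`.
  have hfin := hsub p r
    (fun ζ => F ζ + ((x + g p - ε * (r ^ 2 + ‖p‖ ^ 2) : ℝ) : ℂ)
      - (2 * ε : ℝ) * ((ζ - p) * (starRingEnd ℂ) p))
    hr0 hr (by fun_prop) (by
      intro ζ hζ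
      have hζG : ζ ∈ G := hr (Metric.sphere_subset_closedBall hζ)
      refine (hle ζ hζG).trans (EReal.coe_le_coe_iff.2 (le_of_eq ?_))
      have h1 : ‖ζ - p‖ = r := by rwa [Metric.mem_sphere, dist_eq_norm] at hζ
      rw [hg]
      simp only [Complex.sub_re, Complex.add_re, Complex.ofReal_re, ← h1,
        Complex.ofReal_im,
        Complex.sq_norm, Complex.normSq_apply, Complex.mul_re, Complex.conj_re, Complex.conj_im,
        Complex.sub_im]
      ring)
  rw [hx, EReal.coe_le_coe_iff, hg] at hfin
  simp only [sub_self, zero_mul, mul_zero, Complex.add_re, Complex.ofReal_re, Complex.sub_re,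
    Complex.zero_re] at hfin
  have : 0 < ε * r ^ 2 := by positivity
  linarith

/-! ### A barrier on slit discs -/

/-- The argument of the principal cubic root of `w` is at most `π / 3` in absolute value. -/
theorem half_rpow_le_re_cpow (w : ℂ) :
    ‖w‖ ^ (1 / 3 : ℝ) / 2 ≤ (w ^ ((1 / 3 : ℝ) : ℂ)).re := by
  rcases eq_or_ne w 0 with rfl | hw
  · rw [Complex.zero_cpow (by simp)]
    simp [Real.zero_rpow]
  · have h1 : (w ^ ((1 / 3 : ℝ) : ℂ)).re
        = ‖w‖ ^ (1 / 3 : ℝ) * Real.cos (Complex.arg w * (1 / 3)) := by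
      rw [Complex.cpow_def_of_ne_zero hw, Complex.exp_re, Complex.re_mul_ofReal,
        Complex.im_mul_ofReal, Complex.log_re, Complex.log_im,
        Real.rpow_def_of_pos (norm_pos_iff.2 hw)]
    have h2 : (1 / 2 : ℝ) ≤ Real.cos (Complex.arg w * (1 / 3)) := by
      rw [← Real.cos_pi_div_three, ← Real.cos_abs (Complex.arg w * (1 / 3))]
      have h3 := Complex.abs_arg_le_pi w
      have h4 : |Complex.arg w * (1 / 3)| = |Complex.arg w| / 3 := by
        rw [abs_mul, abs_of_pos (by norm_num : (0 : ℝ) < 1 / 3)]; ring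
      rw [h4]
      have := Real.pi_pos
      exact Real.cos_le_cos_of_nonneg_of_le_pi (by positivity) (by linarith) (by linarith)
    rw [h1, div_eq_mul_one_div]
    gcongr

/-- Two-constant estimate for a subharmonic function on an open part of a disc that omits a radius
(the half-line from the center in the direction `-c⁻¹`): if `v ≤ 1`, and `v` has nonpositive upper
limits at the boundary points inside the disc, then `v` is `O(dist ^ (1 / 3))` at the center, with
a constant that depends on the radius of the disc only. The majorant is the real part of a branch
of the cubic root. -/
theorem IsSubmeanOn.le_rpow {v : ℂ → EReal} {G : Set ℂ} (hsub : IsSubmeanOn v G) (hG : IsOpen G)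
    (husc : UpperSemicontinuousOn v G) (hle : ∀ ζ ∈ G, v ζ ≤ 1)
    {z₀ c : ℂ} {ρ : ℝ} (hρ : 0 < ρ) (hGρ : G ⊆ Metric.ball z₀ ρ) (hc : ‖c‖ = 1)
    (hslit : ∀ ζ ∈ G, c * (ζ - z₀) ∈ Complex.slitPlane)
    (hbd : ∀ q ∈ frontier G, dist q z₀ < ρ → ∀ η : ℝ, 0 < η → ∀ᶠ ζ in 𝓝[G] q, v ζ < (η : EReal))
    {ζ₀ : ℂ} (hζ₀ : ζ₀ ∈ G) :
    v ζ₀ ≤ ((2 * (ρ ^ (1 / 3 : ℝ))⁻¹ * dist ζ₀ z₀ ^ (1 / 3 : ℝ) : ℝ) : EReal) := by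
  have hρ3 : 0 < ρ ^ (1 / 3 : ℝ) := Real.rpow_pos_of_pos hρ _
  obtain ⟨K, hK⟩ : ∃ K : ℝ, K = 2 * (ρ ^ (1 / 3 : ℝ))⁻¹ := ⟨_, rfl⟩
  have hK0 : 0 < K := by rw [hK]; positivity
  have hnorm : ∀ ζ, ‖c * (ζ - z₀)‖ = dist ζ z₀ := fun ζ => by
    rw [norm_mul, hc, one_mul, dist_eq_norm]
  have hF : DifferentiableOn ℂ (fun ζ => (K : ℂ) * (c * (ζ - z₀)) ^ ((1 / 3 : ℝ) : ℂ)) G := by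
    intro ζ hζ
    refine DifferentiableAt.differentiableWithinAt ?_
    exact ((((differentiableAt_id.sub_const z₀).const_mul c).cpow (differentiableAt_const _)
      (hslit ζ hζ)).const_mul _)
  have hlow : ∀ ζ, K * (dist ζ z₀ ^ (1 / 3 : ℝ) / 2)
      ≤ ((K : ℂ) * (c * (ζ - z₀)) ^ ((1 / 3 : ℝ) : ℂ)).re := fun ζ => by
    rw [Complex.re_ofReal_mul, ← hnorm]
    exact mul_le_mul_of_nonneg_left (half_rpow_le_re_cpow _) hK0.le
  have hmain := hsub.le_re hG (Metric.isBounded_ball.subset hGρ) husc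
    (fun ζ hζ => (hle ζ hζ).trans_lt (EReal.coe_lt_top 1)) hF ?_ hζ₀
  · refine hmain.trans (EReal.coe_le_coe_iff.2 ?_)
    rw [Complex.re_ofReal_mul, ← hK]
    refine mul_le_mul_of_nonneg_left ((Complex.re_le_norm _).trans ?_) hK0.le
    rw [Complex.norm_cpow_real, hnorm]
  · intro q hq η hη
    rcases lt_or_ge (dist q z₀) ρ with hqρ | hqρ
    · filter_upwards [hbd q hq hqρ η hη] with ζ hζ
      refine hζ.le.trans (EReal.coe_le_coe_iff.2 ?_)
      have : 0 ≤ K * (dist ζ z₀ ^ (1 / 3 : ℝ) / 2) := by positivity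
      linarith [hlow ζ]
    · have hc1 : Continuous fun ζ => K * (dist ζ z₀ ^ (1 / 3 : ℝ) / 2) + η := by
        have : Continuous fun ζ => dist ζ z₀ ^ (1 / 3 : ℝ) :=
          (by fun_prop : Continuous fun ζ => dist ζ z₀).rpow_const fun _ => Or.inr (by norm_num)
        fun_prop
      have hq1 : 1 < K * (dist q z₀ ^ (1 / 3 : ℝ) / 2) + η := by
        have h1 : ρ ^ (1 / 3 : ℝ) ≤ dist q z₀ ^ (1 / 3 : ℝ) :=
          Real.rpow_le_rpow hρ.le hqρ (by norm_num)
        have h2 : K * (ρ ^ (1 / 3 : ℝ) / 2) = 1 := by rw [hK]; field_simp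
        have h3 : K * (ρ ^ (1 / 3 : ℝ) / 2) ≤ K * (dist q z₀ ^ (1 / 3 : ℝ) / 2) := by gcongr
        linarith
      have hev : ∀ᶠ ζ in 𝓝[G] q, 1 < K * (dist ζ z₀ ^ (1 / 3 : ℝ) / 2) + η :=
        mem_nhdsWithin_of_mem_nhds (hc1.continuousAt.eventually (lt_mem_nhds hq1))
      filter_upwards [hev, self_mem_nhdsWithin] with ζ hζ hζG
      refine (hle ζ hζG).trans ?_
      rw [← EReal.coe_one, EReal.coe_le_coe_iff]
      linarith [hlow ζ]

/-! ### The estimate near a graph -/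

/-- Let `Ω ⊆ ℂⁿ` be open and disjoint, near `p₀`, from the graph `Im z_j = H z`, where `H` does not
depend on `Im z_j`. The functions plurisubharmonic on `Ω`, bounded above by `1`, with nonpositive
upper limits at the boundary points of `Ω` near `p₀`, are small near the point `p₀` of the graph,
uniformly. On the complex line through a point `z` of `Ω` in the direction of the `j`-th axis, one
side of the graph omits the vertical half-line that starts at the point of the graph below or above
`z`, so that the two-constant estimate on slit discs applies. -/
theorem eventually_forall_psh_le {n : ℕ} {Ω T : Set (Fin n → ℂ)} (hΩ : IsOpen Ω) (hT : IsOpen T)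
    {j : Fin n} {H : (Fin n → ℂ) → ℝ} (hH : ContinuousOn H T)
    (hHj : ∀ (z : Fin n → ℂ) (ζ : ℂ), ζ.re = (z j).re → H (Function.update z j ζ) = H z)
    {p₀ : Fin n → ℂ} (hp₀ : p₀ ∈ T) (hHp₀ : (p₀ j).im = H p₀)
    (hgraph : ∀ z ∈ Ω ∩ T, (z j).im ≠ H z) {η : ℝ} (hη : 0 < η) :
    ∀ᶠ z in 𝓝[Ω] p₀, ∀ v : (Fin n → ℂ) → EReal, IsPSHOnCn v Ω → (∀ x ∈ Ω, v x ≤ 1) →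
      (∀ y ∈ frontier Ω ∩ T, ∀ δ : ℝ, 0 < δ → ∀ᶠ x in 𝓝[Ω] y, v x < (δ : EReal)) →
      v z ≤ (η : EReal) := by
  obtain ⟨ρ, hρ, hball⟩ : ∃ ρ : ℝ, 0 < ρ ∧ Metric.ball p₀ (3 * ρ) ⊆ T := by
    obtain ⟨r, hr, hrT⟩ := Metric.isOpen_iff.1 hT p₀ hp₀
    exact ⟨r / 3, by positivity, by rwa [mul_div_cancel₀ r (by norm_num : (3 : ℝ) ≠ 0)]⟩
  have hHc : ContinuousAt H p₀ := hH.continuousAt (hT.mem_nhds hp₀)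
  have hev₁ : ∀ᶠ z in 𝓝 p₀, |H z - (p₀ j).im| < ρ / 2 := by
    have := Metric.tendsto_nhds.1 hHc (ρ / 2) (half_pos hρ)
    filter_upwards [this] with z hz
    rwa [hHp₀, ← Real.dist_eq]
  have hev₂ : ∀ᶠ z in 𝓝 p₀,
      2 * (ρ ^ (1 / 3 : ℝ))⁻¹ * |(z j).im - H z| ^ (1 / 3 : ℝ) < η := by
    have hc : ContinuousAt
        (fun z : Fin n → ℂ => 2 * (ρ ^ (1 / 3 : ℝ))⁻¹ * |(z j).im - H z| ^ (1 / 3 : ℝ)) p₀ := by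
      refine continuousAt_const.mul (ContinuousAt.rpow_const ?_ (Or.inr (by norm_num)))
      exact ((Complex.continuous_im.comp (continuous_apply j)).continuousAt.sub hHc).abs
    refine hc.eventually_lt continuousAt_const ?_
    rw [hHp₀, sub_self, abs_zero, Real.zero_rpow (by norm_num), mul_zero]
    exact hη
  filter_upwards [mem_nhdsWithin_of_mem_nhds hev₁, mem_nhdsWithin_of_mem_nhds hev₂,
    mem_nhdsWithin_of_mem_nhds (Metric.ball_mem_nhds p₀ (half_pos hρ)), self_mem_nhdsWithin]
    with z hz₁ hz₂ hzρ hzΩ v hv hv1 hvbd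
  have hzT : z ∈ T := hball (Metric.ball_subset_ball (by linarith) hzρ)
  have hzj : dist (z j) (p₀ j) < ρ / 2 := (dist_le_pi_dist z p₀ j).trans_lt hzρ
  -- The point of the graph on the vertical line through `z`.
  obtain ⟨z₀, hz₀⟩ : ∃ z₀ : ℂ, z₀ = ⟨(z j).re, H z⟩ := ⟨_, rfl⟩
  have hz₀re : z₀.re = (z j).re := by rw [hz₀]
  have hz₀im : z₀.im = H z := by rw [hz₀]
  have hz₀d : dist z₀ (p₀ j) < 2 * ρ := by
    rw [dist_eq_norm]
    refine (Complex.norm_le_abs_re_add_abs_im _).trans_lt ?_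
    rw [Complex.sub_re, Complex.sub_im, hz₀re, hz₀im]
    have h1 : |(z j).re - (p₀ j).re| ≤ dist (z j) (p₀ j) := by
      rw [dist_eq_norm, ← Complex.sub_re]
      exact Complex.abs_re_le_norm _
    linarith
  have hφ : Continuous fun ζ : ℂ => Function.update z j ζ := continuous_const.update j continuous_id
  have hφT : ∀ ζ, dist ζ z₀ < ρ → Function.update z j ζ ∈ T := by
    intro ζ hζ
    refine hball ?_
    rw [Metric.mem_ball, dist_pi_lt_iff (by positivity)]
    intro i
    by_cases hi : i = j
    · subst hi
      rw [Function.update_self]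
      have := dist_triangle ζ z₀ (p₀ i)
      linarith
    · rw [Function.update_of_ne hi]
      have := (dist_le_pi_dist z p₀ i).trans_lt hzρ
      linarith
  -- The sign `s` tells on which side of the graph `z` lies.
  obtain ⟨s, hs, hsz⟩ : ∃ s : ℝ, (s = 1 ∨ s = -1) ∧ 0 < s * ((z j).im - H z) := by
    rcases lt_or_gt_of_ne (hgraph z ⟨hzΩ, hzT⟩) with h | h
    · exact ⟨-1, Or.inr rfl, by linarith⟩
    · exact ⟨1, Or.inl rfl, by linarith⟩
  -- The set `G` below is the part of the line in `Ω`, on the same side of the graph as `z`.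
  obtain ⟨f, hf⟩ : ∃ f : (Fin n → ℂ) → ℝ, f = fun y => s * ((y j).im - H y) := ⟨_, rfl⟩
  have hfc : ContinuousOn f T := by
    rw [hf]
    exact continuousOn_const.mul
      ((Complex.continuous_im.comp (continuous_apply j)).continuousOn.sub hH)
  obtain ⟨G, hG⟩ : ∃ G : Set ℂ, G = {ζ | dist ζ z₀ < ρ ∧
      Function.update z j ζ ∈ Ω ∩ (T ∩ f ⁻¹' Ioi 0)} := ⟨_, rfl⟩
  have hGo : IsOpen G := by
    rw [hG]
    exact Metric.isOpen_ball.inter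
      ((hΩ.inter (hfc.isOpen_inter_preimage hT isOpen_Ioi)).preimage hφ)
  have hGΩ : ∀ ζ ∈ G, Function.update z j ζ ∈ Ω := fun ζ hζ => by
    rw [hG] at hζ; exact hζ.2.1
  have hzG : z j ∈ G := by
    rw [hG]
    refine ⟨?_, ?_⟩
    · rw [Complex.dist_of_re_eq hz₀re.symm, hz₀im, Real.dist_eq]
      have h1 : |(z j).im - (p₀ j).im| ≤ dist (z j) (p₀ j) := by
        rw [dist_eq_norm, ← Complex.sub_im]
        exact Complex.abs_im_le_norm _
      have h2 := abs_sub_le (z j).im (p₀ j).im (H z)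
      rw [abs_sub_comm (p₀ j).im] at h2
      linarith
    · rw [Function.update_eq_self]
      exact ⟨hzΩ, hzT, by rw [hf]; exact hsz⟩
  have hmain := (hv.isSubmeanOn_update z j hGΩ).le_rpow hGo ?_ (fun ζ hζ => hv1 _ (hGΩ ζ hζ)) hρ
    (z₀ := z₀) (c := -(s : ℂ) * Complex.I) ?_ ?_ ?_ ?_ hzG
  · rw [Function.update_eq_self, Complex.dist_of_re_eq hz₀re.symm, hz₀im, Real.dist_eq] at hmain
    exact hmain.trans (EReal.coe_le_coe_iff.2 hz₂.le)
  · intro ζ hζ y hy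
    exact (hφ.continuousWithinAt.tendsto_nhdsWithin hGΩ).eventually (hv.usc _ (hGΩ ζ hζ) y hy)
  · rw [hG]
    exact fun ζ hζ => hζ.1
  · rcases hs with rfl | rfl <;> simp
  · intro ζ hζ
    rw [Complex.mem_slitPlane_iff]
    have hre : (-(s : ℂ) * Complex.I * (ζ - z₀)).re = s * (ζ.im - H z) := by
      simp [hz₀im]
    have him : (-(s : ℂ) * Complex.I * (ζ - z₀)).im = -s * (ζ.re - (z j).re) := by
      simp [hz₀re]
    rw [hre, him]
    by_cases hζre : ζ.re = (z j).re
    · left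
      rw [hG] at hζ
      have := hζ.2.2.2
      rw [hf, mem_preimage, mem_Ioi, hHj z ζ hζre, Function.update_self] at this
      exact this
    · right
      refine mul_ne_zero ?_ (sub_ne_zero.2 hζre)
      rcases hs with rfl | rfl <;> norm_num
  · intro q hq hqρ δ hδ
    have hqc : q ∈ closure G := frontier_subset_closure hq
    have hqT := hφT q hqρ
    have hqG : q ∉ G := by
      rw [hGo.frontier_eq] at hq
      exact hq.2
    have hqf : 0 ≤ f (Function.update z j q) := by
      have hcw : ContinuousWithinAt (fun ζ => f (Function.update z j ζ)) G q :=
        ((hfc.continuousAt (hT.mem_nhds hqT)).comp (f := fun ζ => Function.update z j ζ)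
          hφ.continuousAt).continuousWithinAt
      have := hcw.mem_closure (t := Ici 0) hqc (fun ζ hζ => by
        rw [hG] at hζ
        have hpos : 0 < f (Function.update z j ζ) := hζ.2.2.2
        exact hpos.le)
      rwa [closure_Ici] at this
    have hqΩ : Function.update z j q ∉ Ω := by
      intro hmem
      refine hqG ?_
      rw [hG]
      refine ⟨hqρ, hmem, hqT, lt_of_le_of_ne hqf ?_⟩
      have hne := hgraph _ ⟨hmem, hqT⟩
      rw [hf]
      refine (mul_ne_zero ?_ (sub_ne_zero.2 hne)).symm
      rcases hs with rfl | rfl <;> norm_num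
    have hqfr : Function.update z j q ∈ frontier Ω := by
      rw [hΩ.frontier_eq]
      exact ⟨hφ.continuousWithinAt.mem_closure hqc hGΩ, hqΩ⟩
    exact (hφ.continuousWithinAt.tendsto_nhdsWithin hGΩ).eventually (hvbd _ ⟨hqfr, hqT⟩ δ hδ)

/-! ### Approach regions -/

theorem circleMean_zero {n : ℕ} (z w : Fin n → ℂ) : circleMean (fun _ => 0) z w = 0 := by
  simp [circleMean]

theorem isPSHOn_zero (n : ℕ) {X : Type*} [TopologicalSpace X] [ChartedSpace (Fin n → ℂ) X]
    (D : Set X) : IsPSHOn n (fun _ => 0) D := by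
  intro e _
  refine ⟨fun _ _ => EReal.coe_lt_top 0, upperSemicontinuousOn_const, fun z w _ => ?_⟩
  rw [circleMean_zero]

namespace ApproachSystem

variable {X : Type*} [TopologicalSpace X] {D : Opens X}

/-- At a boundary point, the regions of a canonical system are traces of neighborhoods, so that the
`𝒜`-upper limit is the full upper limit from inside the domain. -/
theorem eventually_lt_of_alimsup_restrict_le {𝒜 : ApproachSystem D} (h𝒜 : 𝒜.IsCanonical)
    {U : Opens X} {b : X} (hb : b ∈ frontier (D : Set X)) (hbU : b ∈ U) {u : X → EReal}
    (hu : (𝒜.restrict U).alimsup u b ≤ 0) {η : ℝ} (hη : 0 < η) :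
    ∀ᶠ x in 𝓝[(D ⊓ U : Opens X)] b, u x < (η : EReal) := by
  obtain ⟨B, hB, hBV, hreg⟩ := h𝒜 b hb
  obtain ⟨V, hVB, -⟩ := hBV univ isOpen_univ (mem_univ _)
  obtain ⟨hVo, hbV⟩ := hB V hVB
  have hmem : (V ∩ (D : Set X)) ∩ (U : Set X) ∈ (𝒜.restrict U).regions b :=
    Or.inl ⟨hbU, V ∩ (D : Set X), hreg ▸ mem_image_of_mem _ hVB, rfl⟩
  have h1 : limsup u (𝓝[(V ∩ (D : Set X)) ∩ (U : Set X)] b) < (η : EReal) :=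
    ((le_iSup₂ (f := fun R (_ : R ∈ (𝒜.restrict U).regions b) => limsup u (𝓝[R] b)) _ hmem).trans
      hu).trans_lt (EReal.coe_pos.2 hη)
  have h2 := eventually_lt_of_limsup_lt h1
  rwa [inter_assoc, nhdsWithin_inter_of_mem (mem_nhdsWithin_of_mem_nhds (hVo.mem_nhds hbV))] at h2

theorem alimsup_le_zero {𝒜 : ApproachSystem D} {b : X} (hb : b ∈ closure (D : Set X))
    {u : X → EReal} (hu : ∀ η : ℝ, 0 < η → ∀ᶠ x in 𝓝[(D : Set X)] b, u x ≤ (η : EReal)) :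
    𝒜.alimsup u b ≤ 0 := by
  refine iSup₂_le fun R hR => ?_
  refine EReal.le_of_forall_lt_iff_le.1 fun η hη => ?_
  exact limsup_le_of_le (h := (hu η (EReal.coe_pos.1 hη)).filter_mono
    (nhdsWithin_mono _ (𝒜.region_subset b hb R hR)))

theorem relExtremal_nonneg (n : ℕ) [ChartedSpace (Fin n → ℂ) X] (𝒜 : ApproachSystem D)
    (A : Set X) {b : X} (hb : b ∈ frontier (D : Set X)) : 0 ≤ relExtremal n 𝒜 A b := by
  obtain ⟨R, hR⟩ := 𝒜.regions_nonempty b hb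
  have hne : (𝓝[R] b).NeBot := mem_closure_iff_nhdsWithin_neBot.1 (𝒜.mem_closure_region b hb R hR)
  have h0 : ∀ x, 0 ≤ extremalSup n 𝒜 A x := by
    intro x
    refine le_iSup₂_of_le (fun _ => 0) ⟨isPSHOn_zero n _, fun _ _ => zero_le_one, fun a _ => ?_⟩
      le_rfl
    exact iSup₂_le fun R' _ => limsup_le_of_le (h := Eventually.of_forall fun _ => le_rfl)
  refine le_iSup₂_of_le R hR ?_
  exact le_limsup_of_frequently_le (Eventually.of_forall h0).frequently

/-! ### Pluriregularity of hypersurfaces in the boundary -/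

/-- Plurisubharmonic functions that are admissible for `P ∩ U` read, in a chart in which the
boundary of `D` is a graph, as functions to which `eventually_forall_psh_le` applies. Relatively
open pieces `P` of `A` are allowed because the set `Ã` is assembled from such pieces. -/
theorem isLocallyPluriregularAt_of_isTopologicalHypersurface (n : ℕ)
    [ChartedSpace (Fin n → ℂ) X] {𝒜 : ApproachSystem D} (h𝒜 : 𝒜.IsCanonical) {A O : Set X}
    (hA : A ⊆ frontier (D : Set X)) (hAhyp : IsTopologicalHypersurface n A) (hO : IsOpen O)
    (hOA : O ∩ frontier (D : Set X) ⊆ A) {a : X} (haO : a ∈ O) (ha : a ∈ frontier (D : Set X)) :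
    IsLocallyPluriregularAt n 𝒜 (O ∩ frontier (D : Set X)) a := by
  intro U haU
  have haD : a ∉ D := by rw [D.isOpen.frontier_eq] at ha; exact ha.2
  have hafr : a ∈ frontier ((D ⊓ U : Opens X) : Set X) := by
    rw [(D ⊓ U).isOpen.frontier_eq]
    refine ⟨?_, fun h => haD h.1⟩
    rw [Opens.coe_inf, inter_comm]
    exact U.isOpen.inter_closure ⟨haU, frontier_subset_closure ha⟩
  refine le_antisymm (alimsup_le_zero (frontier_subset_closure hafr) fun η hη => ?_)
    (relExtremal_nonneg n _ _ hafr)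
  obtain ⟨e, he, hae, j, -, U', h, hU', hh, hS⟩ := hAhyp a (hOA ⟨haO, ha⟩)
  obtain ⟨β, hβ⟩ : ∃ β : (Fin n → ℂ) → ({i : Fin n // i ≠ j} → ℂ) × ℝ,
      β = fun z => (fun i => z i.1, (z j).re) := ⟨_, rfl⟩
  have hβc : Continuous β := by
    rw [hβ]
    exact (continuous_pi fun i => continuous_apply i.1).prodMk
      (Complex.continuous_re.comp (continuous_apply j))
  have hS' : ∀ z, z ∈ e '' (A ∩ e.source) ↔ β z ∈ U' ∧ (z j).im = h (β z) := by
    intro z; rw [hS, hβ]; rfl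
  obtain ⟨T, hTdef⟩ : ∃ T : Set (Fin n → ℂ),
      T = (e.target ∩ e.symm ⁻¹' (O ∩ (U : Set X))) ∩ β ⁻¹' U' := ⟨_, rfl⟩
  have hT : IsOpen T := by
    rw [hTdef]
    exact (e.isOpen_inter_preimage_symm (hO.inter U.isOpen)).inter (hU'.preimage hβc)
  obtain ⟨Ω, hΩdef⟩ : ∃ Ω : Set (Fin n → ℂ),
      Ω = e.target ∩ e.symm ⁻¹' ((D ⊓ U : Opens X) : Set X) := ⟨_, rfl⟩
  have hΩ : IsOpen Ω := by
    rw [hΩdef]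
    exact e.isOpen_inter_preimage_symm (D ⊓ U).isOpen
  have haS := (hS' (e a)).1 (mem_image_of_mem e ⟨hOA ⟨haO, ha⟩, hae⟩)
  have haT : e a ∈ T := by
    rw [hTdef]
    refine ⟨⟨e.map_source hae, ?_⟩, haS.1⟩
    rw [mem_preimage, e.left_inv hae]
    exact ⟨haO, haU⟩
  have hgraph : ∀ z ∈ Ω ∩ T, (z j).im ≠ h (β z) := by
    rintro z ⟨hzΩ, hzT⟩ hz
    rw [hTdef] at hzT
    rw [hΩdef] at hzΩ
    obtain ⟨x, ⟨hxA, hxe⟩, rfl⟩ := (hS' z).2 ⟨hzT.2, hz⟩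
    have hxD : e.symm (e x) ∈ D := hzΩ.2.1
    rw [e.left_inv hxe] at hxD
    have hxf := hA hxA
    rw [D.isOpen.frontier_eq] at hxf
    exact hxf.2 hxD
  have hunif := eventually_forall_psh_le hΩ hT (j := j) (H := fun z => h (β z))
    (hh.comp hβc.continuousOn fun z hz => by rw [hTdef] at hz; exact hz.2)
    (fun z ζ hζ => by
      have : β (Function.update z j ζ) = β z := by
        rw [hβ]
        simp only [Function.update_self, hζ, Prod.mk.injEq, and_true]
        exact funext fun i => Function.update_of_ne i.2 _ _
      simp only [this])
    haT haS.2 hgraph hη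
  have htend : Tendsto e (𝓝[((D ⊓ U : Opens X) : Set X)] a) (𝓝[Ω] (e a)) := by
    refine tendsto_nhdsWithin_iff.2 ⟨(e.continuousAt hae).tendsto.mono_left nhdsWithin_le_nhds, ?_⟩
    filter_upwards [self_mem_nhdsWithin,
      mem_nhdsWithin_of_mem_nhds (e.open_source.mem_nhds hae)] with x hxD hxe
    rw [hΩdef]
    refine ⟨e.map_source hxe, ?_⟩
    rwa [mem_preimage, e.left_inv hxe]
  filter_upwards [htend.eventually hunif,
    mem_nhdsWithin_of_mem_nhds (e.open_source.mem_nhds hae)] with x hx hxe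
  refine iSup₂_le fun u hu => ?_
  obtain ⟨hpsh, hu1, hulim⟩ := hu
  have key := hx (fun z => u (e.symm z)) (hΩdef ▸ hpsh e he)
    (fun z hz => hu1 _ (by rw [hΩdef] at hz; exact hz.2)) ?_
  · rwa [e.left_inv hxe] at key
  · rintro y ⟨hyfr, hyT⟩ δ hδ
    rw [hTdef] at hyT
    obtain ⟨⟨hyt, hyO, hyU⟩, -⟩ := hyT
    have hyc : ContinuousAt e.symm y := e.continuousAt_symm hyt
    have hmaps : MapsTo e.symm Ω ((D ⊓ U : Opens X) : Set X) := fun z hz => by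
      rw [hΩdef] at hz; exact hz.2
    have hyD : e.symm y ∈ frontier (D : Set X) := by
      rw [D.isOpen.frontier_eq]
      refine ⟨closure_mono inter_subset_left
        (hyc.continuousWithinAt.mem_closure (frontier_subset_closure hyfr) hmaps), fun hmem => ?_⟩
      rw [hΩ.frontier_eq, hΩdef] at hyfr
      exact hyfr.2 ⟨hyt, hmem, hyU⟩
    exact (hyc.continuousWithinAt.tendsto_nhdsWithin hmaps).eventually
      (eventually_lt_of_alimsup_restrict_le h𝒜 hyD hyU (hulim _ ⟨⟨hyO, hyD⟩, hyU⟩) hδ)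

theorem starSet_eq_self (n : ℕ) [ChartedSpace (Fin n → ℂ) X] (𝒜 : ApproachSystem D) {A : Set X}
    (hA : A ⊆ frontier (D : Set X)) : starSet n 𝒜 A = A := by
  refine subset_antisymm ?_ fun x hx => Or.inl ⟨hx, hA hx⟩
  rintro x (hx | ⟨⟨hxA, hxD⟩, -⟩)
  · exact hx.1
  · have hxf := closure_minimal hA isClosed_frontier hxA
    rw [D.isOpen.frontier_eq] at hxf
    exact absurd hxD hxf.2

end ApproachSystem

end SepHolo

theorem mainTheorem12 (n : ℕ) {X : Type*} [TopologicalSpace X] [T2Space X] [SigmaCompactSpace X]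
    [ChartedSpace (Fin n → ℂ) X] [IsManifold 𝓘(ℂ, Fin n → ℂ) ω X]
    (D : Opens X) (𝒜 : SepHolo.ApproachSystem D) (h𝒜 : 𝒜.IsCanonical)
    (A : Set X) (hA : A ⊆ frontier (D : Set X))
    (hAopen : ∃ O : Set X, IsOpen O ∧ A = O ∩ frontier (D : Set X))
    (hAhyp : SepHolo.IsTopologicalHypersurface n A) :
    SepHolo.ApproachSystem.IsLocallyPluriregular n 𝒜 A ∧
      SepHolo.ApproachSystem.tildeSet n 𝒜 A = A := by
  obtain ⟨O, hO, hAO⟩ := hAopen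
  have hreg : ∀ V : Set X, IsOpen V → V ⊆ O →
      SepHolo.ApproachSystem.IsLocallyPluriregular n 𝒜 (V ∩ frontier (D : Set X)) :=
    fun V hV hVO a ha =>
      SepHolo.ApproachSystem.isLocallyPluriregularAt_of_isTopologicalHypersurface n h𝒜 hA hAhyp hV
        (hAO ▸ inter_subset_inter_left _ hVO) ha.1 ha.2
  refine ⟨by rw [hAO]; exact hreg O hO Subset.rfl, ?_⟩
  rw [SepHolo.ApproachSystem.tildeSet, SepHolo.ApproachSystem.starSet_eq_self n 𝒜 hA]
  refine subset_antisymm (sUnion_subset fun P hP => subset_closure.trans hP.2.2) fun a ha => ?_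
  -- `A` itself is not closed: around `a`, a relatively open piece with closure in `A` is used.
  have : LocallyCompactSpace X := ChartedSpace.locallyCompactSpace (Fin n → ℂ) X
  have haO : a ∈ O := by rw [hAO] at ha; exact ha.1
  obtain ⟨V, hV, haV, hVO⟩ : ∃ V : Set X, IsOpen V ∧ a ∈ V ∧ closure V ⊆ O := by
    obtain ⟨K, hK, hKc, hKO⟩ := exists_mem_nhds_isClosed_subset (hO.mem_nhds haO)
    exact ⟨interior K, isOpen_interior, mem_interior_iff_mem_nhds.2 hK,
      (closure_minimal interior_subset hKc).trans hKO⟩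
  refine mem_sUnion.2 ⟨V ∩ frontier (D : Set X), ⟨?_, hreg V hV (subset_closure.trans hVO), ?_⟩,
    haV, hA ha⟩
  · exact inter_subset_right.trans frontier_subset_closure
  · rw [hAO]
    exact (closure_inter_subset_inter_closure _ _).trans
      (inter_subset_inter hVO isClosed_frontier.closure_eq.subset)
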